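/- **Theorem (asymptotic optimality of FMT\*).** Let $d\ge 2$, $\mathcal X=[0,1]^d$, and let $\mathcal X_{\rm obs}\subseteq\mathcal X$ with $\partial\mathcal X\subseteq\mathcal X_{\rm obs}$ and $\mathcal X\setminus\mathcal X_{\rm obs}$ open. Put $\mathcal X_{\rm free}=\mathrm{cl}(\mathcal X\setminus\mathcal X_{\rm obs})$, let $x_{\rm init}\in\mathcal X_{\rm free}$, and let $\mathcal X_{\rm goal}\subseteq\mathcal X_{\rm free}$ be open. A path is a continuous map $\sigma:[0,1]\to\mathbb R^d$ of bounded variation, with cost $c(\sigma)$ its Euclidean arc length. It is feasible if $\sigma([0,1])\subseteq\mathcal X_{\rm free}$, $\sigma(0)=x_{\rm init}$ and $\sigma(1)\in\mathrm{cl}(\mathcal X_{\rm goal})$. Let $c^*$ be the optimal cost, i.e. the infimum of $c(\sigma)$ over feasible paths (the arc length of an optimal path). Assume: * the problem is $\delta$-robustly feasible for some $\delta>0$: there are $\delta_k\in(0,\delta]$ with $\delta_k\to0$ and feasible paths $\sigma_k$ with $c(\sigma_k)\to c^*$ such that, for every $k$, all points of $\sigma_k$ are at distance at least $\delta_k$ from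 every point of $\mathcal X_{\rm obs}$, $\sigma_k(1)\in\partial\mathcal X_{\rm goal}$, and $\sigma_k(\tau)\notin\mathcal X_{\rm goal}$ for $\tau\in(0,1)$; * $\mathcal X_{\rm goal}$ is $\xi$-regular for some $\xi>0$: every $x\in\partial\mathcal X_{\rm goal}$ lies on the boundary of an open ball of radius $\xi$ contained in $\mathcal X_{\rm goal}$; * $x_{\rm init}\notin\partial\mathcal X_{\rm goal}$. Let $\eta>0$ and $$r_n=(1+\eta)\,2\Bigl(\tfrac1d\Bigr)^{1/d}\Bigl(\tfrac{\mu(\mathcal X_{\rm free})}{\zeta_d}\Bigr)^{1/d}\Bigl(\tfrac{\log n}{n}\Bigr)^{1/d},$$ where $\mu$ is Lebesgue measure and $\zeta_d$ is the volume of the unit ball. For every $n$ let $V$ consist of $x_{\rm init}$ and $n$ independent samples, uniformly distributed on $\mathcal X_{\rm free}$. Call $u\ne v$ in $V$ neighbors if $\|u-v\|<r_n$, and call a connection collision-free if the straight segment does not meet $\mathcal X_{\rm obs}$. FMT\* grows a tree rooted at $x_{\rm init}$. Initially $x_{\rm init}$ is open, all other vertices are unvisited, and the current node is $z=x_{\rm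 init}$; for a tree node $y$, $c(y)$ denotes the length of its tree path from $x_{\rm init}$. While $z\notin\mathcal X_{\rm goal}$: for every unvisited neighbor $x$ of $z$, let $y_{\min}$ minimize $c(y)+\|y-x\|$ over the open neighbors $y$ of $x$, and attach $x$ to $y_{\min}$ if that connection is collision-free; after all such $x$ have been considered, make the attached ones open and close $z$; if no node is open, return failure; otherwise let the new $z$ be an open node of least $c$. When $z\in\mathcal X_{\rm goal}$, return the tree path to $z$. Ties may be broken in any way. Let $c_n$ be the arc length of the returned path ($\infty$ for failure). Then $c_n\ge c^*$ always, and for every $\varepsilon>0$ $$\lim_{n\to\infty}\mathbb P\bigl(c_n>(1+\varepsilon)c^*\bigr)=0,$$ that is, $c_n$ converges to $c^*$ in probability. The same two assertions hold for PRM\* with the same samples and radius, that is, with $c_n$ replaced by the length of a shortest path from $x_{\rm init}$ to a vertex in $\mathcal X_{\rm goal}$ in the graph on $V$ whose edges are the collision-free connections between neighbors ($\infty$ if there is none). -/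

import Mathlib

open Set Filter Topology MeasureTheory ProbabilityTheory

/-- Points of `ℝ^d` with the Euclidean norm. -/
abbrev Config (d : ℕ) : Type := EuclideanSpace ℝ (Fin d)

/-- The configuration space `[0,1]^d`. -/
def unitCube (d : ℕ) : Set (Config d) := {x | ∀ i, x i ∈ Set.Icc (0 : ℝ) 1}

/-- A path planning problem in `[0,1]^d`: an obstacle region containing the boundary of the cube
and with open complement in it, an initial configuration in the obstacle-free space
`cl ([0,1]^d \ obs)`, and an open goal region inside the obstacle-free space. -/
structure PlanningProblem (d : ℕ) where
  obs : Set (Config d)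
  init : Config d
  goal : Set (Config d)
  obs_subset : obs ⊆ unitCube d
  frontier_subset_obs : frontier (unitCube d) ⊆ obs
  isOpen_diff_obs : IsOpen (unitCube d \ obs)
  init_mem : init ∈ closure (unitCube d \ obs)
  isOpen_goal : IsOpen goal
  goal_subset : goal ⊆ closure (unitCube d \ obs)

/-- The arc length of a path parametrized by `[0,1]`. -/
noncomputable def arcLength {d : ℕ} (σ : ℝ → Config d) : ENNReal :=
  eVariationOn σ (Set.Icc (0 : ℝ) 1)

/-- A path is a continuous map of bounded variation on `[0,1]`; the values of the Lean function
outside `[0,1]` play no role. -/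
structure IsPath {d : ℕ} (σ : ℝ → Config d) : Prop where
  continuousOn : ContinuousOn σ (Set.Icc (0 : ℝ) 1)
  boundedVariationOn : BoundedVariationOn σ (Set.Icc (0 : ℝ) 1)

namespace PlanningProblem

variable {d : ℕ} (p : PlanningProblem d)

/-- The obstacle-free space. -/
def free : Set (Config d) := closure (unitCube d \ p.obs)

/-- Feasible paths: collision-free paths from the initial configuration to the closure of the
goal region. -/
structure IsFeasible (σ : ℝ → Config d) : Prop where
  isPath : IsPath σ
  collisionFree : ∀ τ ∈ Set.Icc (0 : ℝ) 1, σ τ ∈ p.free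
  source : σ 0 = p.init
  target : σ 1 ∈ closure p.goal

/-- The optimal cost `c*`, the least arc length of a feasible path. It is written as an infimum,
so that no existence of a minimizer is presupposed. -/
noncomputable def optimalCost : ENNReal :=
  ⨅ (σ : ℝ → Config d) (_ : p.IsFeasible σ), arcLength σ

/-- The `δ`-interior of the obstacle-free space. -/
def deltaInterior (δ : ℝ) : Set (Config d) :=
  {x | x ∈ p.free ∧ ∀ y ∈ p.obs, δ ≤ dist x y}

/-- Strong `δ`-clearance of a path. -/
def HasStrongClearance (σ : ℝ → Config d) (δ : ℝ) : Prop :=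
  ∀ τ ∈ Set.Icc (0 : ℝ) 1, σ τ ∈ p.deltaInterior δ

/-- `δ`-robust feasibility. -/
def IsRobustlyFeasible (δ : ℝ) : Prop :=
  ∃ (δs : ℕ → ℝ) (σ : ℕ → ℝ → Config d),
    (∀ n, 0 < δs n) ∧ (∀ n, δs n ≤ δ) ∧ Tendsto δs atTop (𝓝 0) ∧
    (∀ n, p.IsFeasible (σ n)) ∧
    Tendsto (fun n => arcLength (σ n)) atTop (𝓝 p.optimalCost) ∧
    ∀ n, p.HasStrongClearance (σ n) (δs n) ∧
      σ n 1 ∈ frontier p.goal ∧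
      (∀ τ ∈ Set.Ioo (0 : ℝ) 1, σ n τ ∉ p.goal) ∧
      σ n 0 = p.init

/-- `ξ`-regularity of the goal region: every boundary point lies on the boundary of a ball of
radius `ξ` contained in the goal region. -/
def IsRegularGoal (ξ : ℝ) : Prop :=
  0 < ξ ∧ ∀ x ∈ frontier p.goal, ∃ c : Config d,
    Metric.ball c ξ ⊆ p.goal ∧ x ∈ frontier (Metric.ball c ξ)

/-- The straight line joining `u` and `v` does not intersect an obstacle. -/
def CollisionFree (u v : Config d) : Prop := Disjoint (segment ℝ u v) p.obs

/-- The connection radius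
`r_n = (1 + η) 2 (1/d)^{1/d} (μ(X_free) / ζ_d)^{1/d} (log n / n)^{1/d}`, where `ζ_d` is the volume
of the unit ball. -/
noncomputable def radius (η : ℝ) (n : ℕ) : ℝ :=
  (1 + η) * 2 * (1 / (d : ℝ)) ^ (1 / (d : ℝ)) *
    ((volume p.free).toReal / (volume (Metric.ball (0 : Config d) 1)).toReal) ^ (1 / (d : ℝ)) *
    (Real.log n / n) ^ (1 / (d : ℝ))

end PlanningProblem

/-- A rule for `argmin`: it selects some minimizer of a function over a nonempty finite set. Ties
may be broken in any way. -/
structure ArgminRule (α : Type) where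
  pick : (α → ℝ) → Finset α → α
  pick_mem : ∀ (f : α → ℝ) (S : Finset α), S.Nonempty → pick f S ∈ S
  pick_le : ∀ (f : α → ℝ) (S : Finset α), ∀ y ∈ S, f (pick f S) ≤ f y

/-- The length of the polygonal line through a list of points. -/
noncomputable def polyLength {d : ℕ} : List (Config d) → ℝ
  | a :: b :: l => dist a b + polyLength (b :: l)
  | _ => 0

open Classical in
/-- The vertex set: the initial configuration together with the samples. -/
noncomputable def vertexSet {d n : ℕ} (x₀ : Config d) (x : Fin n → Config d) :
    Finset (Config d) :=
  insert x₀ (Finset.univ.image x)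

open Classical in
/-- The points of `V \ {v}` at distance less than `r` from `v`. -/
noncomputable def near {d : ℕ} (V : Finset (Config d)) (v : Config d) (r : ℝ) :
    Finset (Config d) :=
  (V.erase v).filter fun u => dist u v < r

/-- The state of the Fast Marching Tree algorithm. The tree is stored through its branches: for a
node `v` of the tree, `branch v` lists the nodes of the unique tree path between `v` and the root,
starting with `v` and ending with the root. -/
structure FMTState (d : ℕ) where
  unvisited : Finset (Config d)
  active : Finset (Config d)
  closed : Finset (Config d)
  branch : Config d → List (Config d)
  current : Config d

namespace FMTState

variable {d : ℕ}

/-- The cost-to-arrive of a node: the length of its tree path. -/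
noncomputable def cost (s : FMTState d) (v : Config d) : ℝ := polyLength (s.branch v)

open Classical in
/-- Initialization: the tree consists of the root, all other vertices are unvisited. -/
noncomputable def initial (V : Finset (Config d)) (x₀ : Config d) : FMTState d where
  unvisited := V.erase x₀
  active := {x₀}
  closed := ∅
  branch := fun _ => [x₀]
  current := x₀

open Classical in
/-- The locally optimal parent of `x`: the minimizer of `c(y) + ‖y - x‖` among the neighbors `y`
of `x` that are open (obstacles are ignored). -/
noncomputable def bestParent (A : ArgminRule (Config d)) (V : Finset (Config d)) (r : ℝ)
    (s : FMTState d) (x : Config d) : Config d :=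
  A.pick (fun y => s.cost y + dist y x) (near V x r ∩ s.active)

open Classical in
/-- The vertices connected to the tree in one iteration: the unvisited neighbors `x` of the current
node for which the line from the locally optimal parent is collision-free. -/
noncomputable def connected (p : PlanningProblem d) (A : ArgminRule (Config d))
    (V : Finset (Config d)) (r : ℝ) (s : FMTState d) : Finset (Config d) :=
  (near V s.current r ∩ s.unvisited).filter fun x => p.CollisionFree (s.bestParent A V r x) x

open Classical in
/-- One iteration: connect the new vertices, close the current node, and take an open node of
least cost-to-arrive as the next current node (meaningless if no node is open any more; the main
loop reports failure in that case). -/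
noncomputable def step (p : PlanningProblem d) (A : ArgminRule (Config d))
    (V : Finset (Config d)) (r : ℝ) (s : FMTState d) : FMTState d :=
  let new := s.connected p A V r
  let active' := (s.active ∪ new).erase s.current
  let branch' : Config d → List (Config d) :=
    fun x => if x ∈ new then x :: s.branch (s.bestParent A V r x) else s.branch x
  { unvisited := s.unvisited \ new
    active := active'
    closed := insert s.current s.closed
    branch := branch'
    current := A.pick (fun y => polyLength (branch' y)) active' }

open Classical in
/-- The main loop, with a bound on the number of iterations. It returns the branch of the current
node as soon as this node lies in the goal region, and `none` (failure) as soon as no node is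
open. -/
noncomputable def run (p : PlanningProblem d) (A : ArgminRule (Config d))
    (V : Finset (Config d)) (r : ℝ) : ℕ → FMTState d → Option (List (Config d))
  | 0, s => if s.current ∈ p.goal then some (s.branch s.current) else none
  | k + 1, s =>
    if s.current ∈ p.goal then some (s.branch s.current)
    else if (s.step p A V r).active = ∅ then none
    else run p A V r k (s.step p A V r)

theorem step_active_card_lt (p : PlanningProblem d) (A : ArgminRule (Config d))
    (V : Finset (Config d)) (r : ℝ) (s : FMTState d) (hs : s.current ∈ s.active) :
    (s.step p A V r).unvisited.card + (s.step p A V r).active.card <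
      s.unvisited.card + s.active.card := by
  classical
  have hsub : s.connected p A V r ⊆ s.unvisited := fun x hx =>
    (Finset.mem_inter.1 (Finset.mem_filter.1 hx).1).2
  have h1 : (s.unvisited \ s.connected p A V r).card + (s.connected p A V r).card =
      s.unvisited.card := Finset.card_sdiff_add_card_eq_card hsub
  have h2 := Finset.card_union_le s.active (s.connected p A V r)
  have h3 := Finset.card_erase_lt_of_mem (s := s.active ∪ s.connected p A V r)
    (Finset.mem_union_left _ hs)
  have h4 : (s.step p A V r).unvisited.card = (s.unvisited \ s.connected p A V r).card := by
    simp [step]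
  have h5 : (s.step p A V r).active.card =
      ((s.active ∪ s.connected p A V r).erase s.current).card := by
    simp [step]
  omega

/-- The bound on the number of iterations is immaterial: every iteration removes a vertex for good,
so that the loop has ended on its own when the bound is reached. -/
theorem run_succ (p : PlanningProblem d) (A : ArgminRule (Config d))
    (V : Finset (Config d)) (r : ℝ) : ∀ (k : ℕ) (s : FMTState d), s.current ∈ s.active →
    s.unvisited.card + s.active.card ≤ k → run p A V r (k + 1) s = run p A V r k s := by
  classical
  intro k
  induction k with
  | zero =>
    intro s hs hk
    have := Finset.card_pos.2 ⟨_, hs⟩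
    omega
  | succ k ih =>
    intro s hs hk
    rw [run]
    conv_rhs => rw [run]
    split_ifs with h1 h2
    · rfl
    · rfl
    · refine ih _ ?_ ?_
      · exact A.pick_mem _ _ (Finset.nonempty_iff_ne_empty.2 h2)
      · have := step_active_card_lt p A V r s hs
        omega

end FMTState

/-- The path returned by the Fast Marching Tree algorithm on the vertex set `V` with connection
radius `r` (`none` for failure). There are at most `V.card` iterations. -/
noncomputable def fmtPath {d : ℕ} (p : PlanningProblem d) (A : ArgminRule (Config d))
    (V : Finset (Config d)) (r : ℝ) : Option (List (Config d)) :=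
  FMTState.run p A V r V.card (FMTState.initial V p.init)

/-- The arc length of the path returned by the Fast Marching Tree algorithm, `∞` for failure. -/
noncomputable def fmtCost {d : ℕ} (p : PlanningProblem d) (A : ArgminRule (Config d))
    (V : Finset (Config d)) (r : ℝ) : ENNReal :=
  match fmtPath p A V r with
  | none => ⊤
  | some l => ENNReal.ofReal (polyLength l)

/-- The roadmap of PRM*: vertices at distance less than `r` are joined whenever the straight line
between them is collision-free. -/
def roadmap {d : ℕ} (p : PlanningProblem d) (V : Finset (Config d)) (r : ℝ) :
    SimpleGraph (Config d) where
  Adj u v := u ≠ v ∧ u ∈ V ∧ v ∈ V ∧ dist u v < r ∧ p.CollisionFree u v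
  symm := ⟨fun u v ⟨h1, h2, h3, h4, h5⟩ =>
    ⟨h1.symm, h3, h2, by rwa [dist_comm], by
      unfold PlanningProblem.CollisionFree at h5 ⊢; rwa [segment_symm]⟩⟩
  loopless := ⟨fun u h => h.1 rfl⟩

/-- The cost of the PRM* solution: the length of a shortest path in the roadmap from the initial
configuration to a vertex in the goal region, `∞` if there is none. -/
noncomputable def prmCost {d : ℕ} (p : PlanningProblem d) (V : Finset (Config d)) (r : ℝ) :
    ENNReal :=
  ⨅ (z : Config d) (_ : z ∈ V) (_ : z ∈ p.goal) (w : (roadmap p V r).Walk p.init z),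
    ENNReal.ofReal (polyLength w.support)

/-! The lower bounds are deterministic. A collision-free segment starting in the free space stays
there, because the boundary of the cube is an obstacle, so every roadmap walk to the goal traces a
feasible path of the same length or less (`exists_isPath_of_walk`). A branch of the FMT* tree is
itself such a walk, whence `optimalCost ≤ prmCost ≤ fmtCost`, and only FMT* needs an upper bound.

Although FMT* ignores obstacles when choosing parents, it does at least as well as any chain of
vertices with steps shorter than `r` whose members have clearance `r`
(`fmtCost_le_of_isClearChain`). Along such a chain no attachment is ever rejected, and an induction
over the iterations shows that each open chain vertex costs at most the chain up to it.

To produce a chain, fix one robust path of length close to `c*` and place waypoints along it at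
spacing at most `θ r_n`, ending slightly inside the goal. Around each waypoint take a ball of radius
`a r_n` and one of radius `b r_n`. A ball of radius `a r_n` is missed by all samples with
probability at most `n ^ (-(2(1+η)a)^d/d)`. As `η > 0`, one can have `θ + 2a = 1` and still an
exponent above `1/d`; there are only `O(n^(1/d))` waypoints, so with high probability all large
balls are hit and a chain exists. For its length, the small balls need not all be hit: by Markov's
inequality, only a small fraction of them is missed, and each missed one costs at most two steps of
length `r_n` (`fmtCost_le_of_waypoints`, `measure_lt_fmtCost_le`). -/

theorem isClosed_unitCube (d : ℕ) : IsClosed (unitCube d) := by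
  have : unitCube d = ⋂ i, (fun x : Config d => x i) ⁻¹' Set.Icc (0 : ℝ) 1 := by
    ext x; simp [unitCube]
  rw [this]
  exact isClosed_iInter fun i => isClosed_Icc.preimage (by fun_prop)

/-! ### Collision-free connected sets and the free space -/

namespace PlanningProblem

variable {d : ℕ} (p : PlanningProblem d)

theorem free_subset_unitCube : p.free ⊆ unitCube d :=
  closure_minimal sdiff_subset (isClosed_unitCube d)

/-- A connected set that avoids the obstacles cannot leave the cube. -/
theorem subset_free_of_isPreconnected {s : Set (Config d)} (hs : IsPreconnected s)
    (hobs : Disjoint s p.obs) {x : Config d} (hxs : x ∈ s) (hx : x ∈ p.free) : s ⊆ p.free := by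
  have hfr : ∀ y ∈ s, y ∉ frontier (unitCube d) := fun y hy h =>
    Set.disjoint_left.1 hobs hy (p.frontier_subset_obs h)
  have hint : ∀ y ∈ s, y ∈ unitCube d → y ∈ interior (unitCube d) := fun y hy h => by
    by_contra h'
    exact hfr y hy ⟨subset_closure h, h'⟩
  -- A set missing the frontier is covered by the disjoint open sets interior and complement of the
  -- cube; connectedness selects the interior.
  have hsub : s ⊆ interior (unitCube d) := by
    refine hs.subset_left_of_subset_union isOpen_interior (isClosed_unitCube d).isOpen_compl
      ?_ ?_ ⟨x, hxs, hint x hxs (p.free_subset_unitCube hx)⟩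
    · exact Set.disjoint_left.2 fun y hy h => h (interior_subset hy)
    · intro y hy
      by_cases h : y ∈ unitCube d
      · exact Or.inl (hint y hy h)
      · exact Or.inr h
  exact fun y hy => subset_closure ⟨interior_subset (hsub hy), Set.disjoint_left.1 hobs hy⟩

end PlanningProblem

/-! ### Roadmap walks as feasible paths -/

theorem eVariationOn_lineMap_le {d : ℕ} (u v : Config d) :
    eVariationOn (fun t : ℝ => AffineMap.lineMap u v t) (Set.Icc (0 : ℝ) 1) ≤ edist u v := by
  have hL : LipschitzOnWith (nndist u v) (fun t : ℝ => (AffineMap.lineMap u v t : Config d))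
      Set.univ := (lipschitzWith_lineMap u v).lipschitzOnWith
  refine (hL.comp_eVariationOn_le (g := id) (s := Set.Icc (0 : ℝ) 1)
    (fun _ _ => mem_univ _)).trans ?_
  have h := (monotoneOn_id (s := Set.Icc (0 : ℝ) 1)).eVariationOn_eq
    (left_mem_Icc.2 zero_le_one) (right_mem_Icc.2 zero_le_one)
  rw [Set.inter_self] at h
  rw [h]
  rw [id, id, sub_zero, ENNReal.ofReal_one, mul_one, edist_nndist]

/-- Paths inside `s` from `u` to `w` can be preceded by a segment. -/
theorem exists_isPath_segment_trans {d : ℕ} {s : Set (Config d)} {u v w : Config d}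
    (hseg : segment ℝ u v ⊆ s) {σ : ℝ → Config d} (hσ : IsPath σ)
    (hs : ∀ τ ∈ Set.Icc (0 : ℝ) 1, σ τ ∈ s) (h0 : σ 0 = v) (h1 : σ 1 = w) :
    ∃ σ' : ℝ → Config d, IsPath σ' ∧ (∀ τ ∈ Set.Icc (0 : ℝ) 1, σ' τ ∈ s) ∧ σ' 0 = u ∧ σ' 1 = w ∧
      arcLength σ' ≤ edist u v + arcLength σ := by
  set f : ℝ → Config d := fun t => AffineMap.lineMap u v (2 * t) with hf
  set g : ℝ → Config d := fun t => σ (2 * t - 1) with hg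
  set σ' : ℝ → Config d := fun t => if t ≤ 1 / 2 then f t else g t with hσ'
  have hleft : EqOn σ' f (Set.Icc 0 (1 / 2)) := fun t ht => by simp only [hσ']; rw [if_pos ht.2]
  have hright : EqOn σ' g (Set.Icc (1 / 2) 1) := fun t ht => by
    simp only [hσ']
    split_ifs with h
    · have : t = 1 / 2 := le_antisymm h ht.1
      subst this
      simp only [hf, hg]
      norm_num [h0]
    · rfl
  have hunion : Set.Icc (0 : ℝ) (1 / 2) ∪ Set.Icc (1 / 2) 1 = Set.Icc 0 1 :=
    Set.Icc_union_Icc_eq_Icc (by norm_num) (by norm_num)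
  have hmapf : MapsTo (fun t : ℝ => 2 * t) (Set.Icc 0 (1 / 2)) (Set.Icc 0 1) :=
    fun t ht => ⟨by linarith [ht.1], by linarith [ht.2]⟩
  have hmapg : MapsTo (fun t : ℝ => 2 * t - 1) (Set.Icc (1 / 2) 1) (Set.Icc 0 1) :=
    fun t ht => ⟨by linarith [ht.1], by linarith [ht.2]⟩
  have hvar : arcLength σ' ≤ edist u v + arcLength σ := by
    have h := eVariationOn.Icc_add_Icc σ' (s := Set.univ) (a := (0 : ℝ)) (b := 1 / 2) (c := 1)
      (by norm_num) (by norm_num) (mem_univ _)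
    simp only [Set.univ_inter] at h
    rw [arcLength, ← h, eVariationOn.congr hleft, eVariationOn.congr hright]
    refine add_le_add ?_ ?_
    · refine le_trans ?_ (eVariationOn_lineMap_le u v)
      exact eVariationOn.comp_le_of_monotoneOn (fun t : ℝ => (AffineMap.lineMap u v t : Config d))
        (fun t : ℝ => 2 * t) (fun a _ b _ hab => by dsimp only; linarith) hmapf
    · exact eVariationOn.comp_le_of_monotoneOn σ (fun t : ℝ => 2 * t - 1)
        (fun a _ b _ hab => by dsimp only; linarith) hmapg
  refine ⟨σ', ⟨?_, ?_⟩, ?_, ?_, ?_, hvar⟩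
  · rw [← hunion]
    refine ContinuousOn.union_of_isClosed ?_ ?_ isClosed_Icc isClosed_Icc
    · refine ContinuousOn.congr (Continuous.continuousOn ?_) hleft
      exact AffineMap.lineMap_continuous.comp (by fun_prop)
    · refine ContinuousOn.congr ?_ hright
      exact hσ.continuousOn.comp (by fun_prop) hmapg
  · exact ne_top_of_le_ne_top (ENNReal.add_ne_top.2 ⟨edist_ne_top _ _, hσ.boundedVariationOn⟩) hvar
  · rintro τ hτ
    rw [← hunion] at hτ
    rcases hτ with hτ | hτ
    · rw [hleft hτ]
      refine hseg ?_
      rw [segment_eq_image_lineMap]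
      exact ⟨_, hmapf hτ, rfl⟩
    · rw [hright hτ]
      exact hs _ (hmapg hτ)
  · rw [hleft ⟨le_rfl, by norm_num⟩]; simp [hf]
  · rw [hright ⟨by norm_num, le_rfl⟩]; simp only [hg]; norm_num [h1]

theorem polyLength_nonneg {d : ℕ} : ∀ l : List (Config d), 0 ≤ polyLength l
  | [] => le_rfl
  | [_] => le_rfl
  | _ :: b :: l => add_nonneg dist_nonneg (polyLength_nonneg (b :: l))

theorem polyLength_support_cons {d : ℕ} {G : SimpleGraph (Config d)} {u v w : Config d}
    (h : G.Adj u v) (q : G.Walk v w) :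
    polyLength (SimpleGraph.Walk.cons h q).support = dist u v + polyLength q.support := by
  cases q <;> rfl

theorem polyLength_support_concat {d : ℕ} {G : SimpleGraph (Config d)} {u v w : Config d}
    (q : G.Walk u v) (h : G.Adj v w) :
    polyLength (q.concat h).support = polyLength q.support + dist v w := by
  induction q with
  | nil => simp [SimpleGraph.Walk.concat, polyLength]
  | cons h' q ih =>
    rw [SimpleGraph.Walk.concat_cons, polyLength_support_cons, polyLength_support_cons, ih,
      add_assoc]

/-- The polygonal line along a walk in the roadmap is a path in the free space. -/
theorem exists_isPath_of_walk {d : ℕ} (p : PlanningProblem d) (V : Finset (Config d)) (r : ℝ)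
    {u v : Config d} (w : (roadmap p V r).Walk u v) (hu : u ∈ p.free) :
    ∃ σ : ℝ → Config d, IsPath σ ∧ (∀ τ ∈ Set.Icc (0 : ℝ) 1, σ τ ∈ p.free) ∧ σ 0 = u ∧ σ 1 = v ∧
      arcLength σ ≤ ENNReal.ofReal (polyLength w.support) := by
  induction w with
  | @nil u =>
    have h0 : arcLength (fun _ : ℝ => u) = 0 :=
      eVariationOn.constant_on (by rintro _ ⟨_, -, rfl⟩ _ ⟨_, -, rfl⟩; rfl)
    refine ⟨fun _ => u, ⟨continuousOn_const, ?_⟩, fun _ _ => hu, rfl, rfl, ?_⟩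
    · change arcLength (fun _ : ℝ => u) ≠ ⊤
      simp [h0]
    · simp [h0]
  | @cons u v _ h q ih =>
    have hseg : segment ℝ u v ⊆ p.free :=
      p.subset_free_of_isPreconnected (convex_segment u v).isPreconnected h.2.2.2.2
        (left_mem_segment ℝ u v) hu
    obtain ⟨σ, hσ, hs, h0, h1, hlen⟩ := ih (hseg (right_mem_segment ℝ u v))
    obtain ⟨σ', hσ', hs', h0', h1', hlen'⟩ := exists_isPath_segment_trans hseg hσ hs h0 h1
    refine ⟨σ', hσ', hs', h0', h1', hlen'.trans ?_⟩
    rw [polyLength_support_cons, ENNReal.ofReal_add dist_nonneg (polyLength_nonneg _),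
      edist_dist]
    gcongr

theorem optimalCost_le_prmCost {d : ℕ} (p : PlanningProblem d) (V : Finset (Config d)) (r : ℝ) :
    p.optimalCost ≤ prmCost p V r := by
  refine le_iInf fun z => le_iInf fun _ => le_iInf fun hz => le_iInf fun w => ?_
  obtain ⟨σ, hσ, hs, h0, h1, hlen⟩ := exists_isPath_of_walk p V r w p.init_mem
  exact (iInf₂_le σ ⟨hσ, hs, h0, h1 ▸ subset_closure hz⟩).trans hlen

/-! ### Invariants of the FMT* loop -/

namespace FMTState

variable {d : ℕ}

/-- The invariants of the Fast Marching Tree algorithm. -/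
structure IsValid (p : PlanningProblem d) (V : Finset (Config d)) (r : ℝ) (s : FMTState d) :
    Prop where
  current_mem : s.current ∈ s.active
  active_subset : s.active ⊆ V
  covers : ∀ v ∈ V, v ∈ s.unvisited ∨ v ∈ s.active ∨ v ∈ s.closed
  notMem_active : ∀ v ∈ s.unvisited, v ∉ s.active
  init_notMem : p.init ∉ s.unvisited
  current_le : ∀ y ∈ s.active, s.cost s.current ≤ s.cost y
  closed_notMem_goal : ∀ v ∈ s.closed, v ∉ p.goal
  branch_head : ∀ v ∈ s.active, ∃ l, s.branch v = v :: l
  exists_walk : ∀ v ∈ s.active, ∃ w : (roadmap p V r).Walk p.init v,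
    polyLength w.support = s.cost v

theorem mem_near {V : Finset (Config d)} {u v : Config d} {r : ℝ} :
    u ∈ near V v r ↔ u ≠ v ∧ u ∈ V ∧ dist u v < r := by
  simp [near, and_assoc]

theorem mem_connected {p : PlanningProblem d} {A : ArgminRule (Config d)}
    {V : Finset (Config d)} {r : ℝ} {s : FMTState d} {x : Config d} :
    x ∈ s.connected p A V r ↔
      x ∈ near V s.current r ∧ x ∈ s.unvisited ∧ p.CollisionFree (s.bestParent A V r x) x := by
  simp [connected, and_assoc]

theorem mem_step_active {p : PlanningProblem d} {A : ArgminRule (Config d)}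
    {V : Finset (Config d)} {r : ℝ} {s : FMTState d} {x : Config d} :
    x ∈ (s.step p A V r).active ↔
      x ≠ s.current ∧ (x ∈ s.active ∨ x ∈ s.connected p A V r) := by
  simp [step]

theorem mem_step_unvisited {p : PlanningProblem d} {A : ArgminRule (Config d)}
    {V : Finset (Config d)} {r : ℝ} {s : FMTState d} {x : Config d} :
    x ∈ (s.step p A V r).unvisited ↔ x ∈ s.unvisited ∧ x ∉ s.connected p A V r := by
  simp [step]

theorem mem_step_closed {p : PlanningProblem d} {A : ArgminRule (Config d)}
    {V : Finset (Config d)} {r : ℝ} {s : FMTState d} {x : Config d} :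
    x ∈ (s.step p A V r).closed ↔ x = s.current ∨ x ∈ s.closed := by
  simp [step]

theorem step_branch_of_mem {p : PlanningProblem d} {A : ArgminRule (Config d)}
    {V : Finset (Config d)} {r : ℝ} {s : FMTState d} {x : Config d}
    (hx : x ∈ s.connected p A V r) :
    (s.step p A V r).branch x = x :: s.branch (s.bestParent A V r x) := by
  simp [step, hx]

theorem step_branch_of_notMem {p : PlanningProblem d} {A : ArgminRule (Config d)}
    {V : Finset (Config d)} {r : ℝ} {s : FMTState d} {x : Config d}
    (hx : x ∉ s.connected p A V r) :
    (s.step p A V r).branch x = s.branch x := by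
  simp [step, hx]

theorem IsValid.current_mem_near {p : PlanningProblem d}
    {V : Finset (Config d)} {r : ℝ} {s : FMTState d} (hs : s.IsValid p V r) {x : Config d}
    (hx : x ∈ near V s.current r) : s.current ∈ near V x r := by
  rw [mem_near] at hx ⊢
  exact ⟨hx.1.symm, hs.active_subset hs.current_mem, by rw [dist_comm]; exact hx.2.2⟩

theorem IsValid.bestParent_mem {p : PlanningProblem d} (A : ArgminRule (Config d))
    {V : Finset (Config d)} {r : ℝ} {s : FMTState d} (hs : s.IsValid p V r) {x : Config d}
    (hx : x ∈ near V s.current r) :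
    s.bestParent A V r x ∈ near V x r ∧ s.bestParent A V r x ∈ s.active := by
  classical
  have h : (near V x r ∩ s.active).Nonempty :=
    ⟨s.current, Finset.mem_inter.2 ⟨hs.current_mem_near hx, hs.current_mem⟩⟩
  have := A.pick_mem (fun y => s.cost y + dist y x) _ h
  rw [Finset.mem_inter] at this
  rw [bestParent]
  convert this

theorem bestParent_le (A : ArgminRule (Config d)) {V : Finset (Config d)} {r : ℝ}
    {s : FMTState d} {x y : Config d} (hy : y ∈ near V x r) (hya : y ∈ s.active) :
    s.cost (s.bestParent A V r x) + dist (s.bestParent A V r x) x ≤ s.cost y + dist y x := by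
  classical
  have := A.pick_le (fun y => s.cost y + dist y x) (near V x r ∩ s.active) y
    (Finset.mem_inter.2 ⟨hy, hya⟩)
  rw [bestParent]
  convert this

theorem IsValid.step_cost_of_mem {p : PlanningProblem d} {A : ArgminRule (Config d)}
    {V : Finset (Config d)} {r : ℝ} {s : FMTState d} (hs : s.IsValid p V r) {x : Config d}
    (hx : x ∈ s.connected p A V r) :
    (s.step p A V r).cost x =
      s.cost (s.bestParent A V r x) + dist (s.bestParent A V r x) x := by
  obtain ⟨l, hl⟩ := hs.branch_head _ (hs.bestParent_mem A (mem_connected.1 hx).1).2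
  rw [cost, step_branch_of_mem hx, cost, hl, polyLength, dist_comm, add_comm]

theorem step_cost_of_notMem {p : PlanningProblem d} {A : ArgminRule (Config d)}
    {V : Finset (Config d)} {r : ℝ} {s : FMTState d} {x : Config d}
    (hx : x ∉ s.connected p A V r) : (s.step p A V r).cost x = s.cost x := by
  rw [cost, step_branch_of_notMem hx, cost]

/-- A new vertex hangs below its best parent, which is open and hence already reached by a walk of
matching length; one more roadmap edge extends that walk. All other open vertices keep their
branches. -/
theorem IsValid.step {p : PlanningProblem d} {A : ArgminRule (Config d)}
    {V : Finset (Config d)} {r : ℝ} {s : FMTState d} (hs : s.IsValid p V r)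
    (hgoal : s.current ∉ p.goal) (hne : (s.step p A V r).active.Nonempty) :
    (s.step p A V r).IsValid p V r where
  current_mem := A.pick_mem _ _ hne
  active_subset x hx := by
    rcases (mem_step_active.1 hx).2 with h | h
    · exact hs.active_subset h
    · exact (mem_near.1 (mem_connected.1 h).1).2.1
  covers v hv := by
    rw [mem_step_unvisited, mem_step_active, mem_step_closed]
    have := hs.covers v hv
    by_cases h : v = s.current
    · exact Or.inr (Or.inr (Or.inl h))
    · tauto
  notMem_active v hv hva := by
    rw [mem_step_unvisited] at hv
    rcases (mem_step_active.1 hva).2 with h | h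
    · exact hs.notMem_active v hv.1 h
    · exact hv.2 h
  init_notMem h := hs.init_notMem (mem_step_unvisited.1 h).1
  current_le := A.pick_le _ _
  closed_notMem_goal v hv := by
    rcases mem_step_closed.1 hv with rfl | h
    · exact hgoal
    · exact hs.closed_notMem_goal v h
  branch_head v hv := by
    by_cases h : v ∈ s.connected p A V r
    · exact ⟨_, step_branch_of_mem h⟩
    · rw [step_branch_of_notMem h]
      exact hs.branch_head v ((mem_step_active.1 hv).2.resolve_right h)
  exists_walk v hv := by
    by_cases h : v ∈ s.connected p A V r
    · obtain ⟨hn, -, hfree⟩ := mem_connected.1 h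
      obtain ⟨hb, hba⟩ := hs.bestParent_mem A hn
      obtain ⟨w, hw⟩ := hs.exists_walk _ hba
      rw [mem_near] at hb hn
      have hadj : (roadmap p V r).Adj (s.bestParent A V r v) v :=
        ⟨hb.1, hb.2.1, hn.2.1, hb.2.2, hfree⟩
      refine ⟨w.concat hadj, ?_⟩
      rw [polyLength_support_concat, hw, hs.step_cost_of_mem h]
    · rw [step_cost_of_notMem h]
      exact hs.exists_walk v ((mem_step_active.1 hv).2.resolve_right h)

theorem isValid_initial (p : PlanningProblem d) (V : Finset (Config d)) (r : ℝ)
    (h : p.init ∈ V) : (initial V p.init).IsValid p V r where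
  current_mem := by simp [initial]
  active_subset := by simpa [initial] using h
  covers v hv := by by_cases hv' : v = p.init <;> simp [initial, hv, hv']
  notMem_active v hv := by simpa [initial] using (Finset.mem_erase.1 hv).1
  init_notMem := by simp [initial]
  current_le y hy := le_rfl
  closed_notMem_goal := by simp [initial]
  branch_head v hv := by simp_all [initial]
  exists_walk v hv := by
    have : v = p.init := by simpa [initial] using hv
    subst this
    exact ⟨.nil, rfl⟩

/-- The returned branch is the branch of a goal vertex in a state satisfying the invariants. -/
theorem exists_isValid_of_run_eq_some {p : PlanningProblem d} {A : ArgminRule (Config d)}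
    {V : Finset (Config d)} {r : ℝ} {l : List (Config d)} : ∀ (k : ℕ) (s : FMTState d),
    s.IsValid p V r → run p A V r k s = some l →
    ∃ s' : FMTState d, s'.IsValid p V r ∧ s'.current ∈ p.goal ∧ s'.branch s'.current = l := by
  intro k
  induction k with
  | zero =>
    intro s hs h
    rw [run] at h
    split_ifs at h with h1
    exact ⟨s, hs, h1, by simpa using h⟩
  | succ k ih =>
    intro s hs h
    rw [run] at h
    split_ifs at h with h1 h2
    · exact ⟨s, hs, h1, by simpa using h⟩
    · exact ih _ (hs.step h1 (Finset.nonempty_iff_ne_empty.2 h2)) h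

/-! ### Comparison of FMT* with a clear chain -/

/-- A chain of vertices with steps shorter than `r` from the initial configuration to the goal
that has enough clearance for every connection to one of its vertices to be collision-free. -/
structure IsClearChain (p : PlanningProblem d) (V : Finset (Config d)) (r : ℝ)
    (y : ℕ → Config d) (M : ℕ) : Prop where
  source : y 0 = p.init
  target : y M ∈ p.goal
  mem : ∀ m ≤ M, y m ∈ V
  dist_lt : ∀ m < M, dist (y m) (y (m + 1)) < r
  collisionFree : ∀ m ≤ M, ∀ u, dist u (y m) < r → p.CollisionFree u (y m)

/-- The additional invariants for a chain of vertices: its nodes have been reached at most at the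
cost of the chain. -/
structure Follows (s : FMTState d) (y : ℕ → Config d) (M : ℕ) : Prop where
  cost_le : ∀ m ≤ M, y m ∈ s.active →
    s.cost (y m) ≤ ∑ i ∈ Finset.range m, dist (y i) (y (i + 1))
  notMem_of_closed : ∀ m < M, y m ∈ s.closed → y (m + 1) ∉ s.unvisited

/-- The first unvisited chain vertex is not the root, so it has a predecessor. That predecessor is
not unvisited by minimality, and not closed because closed chain vertices have visited successors;
it must be open. -/
theorem IsValid.exists_active {p : PlanningProblem d} {V : Finset (Config d)} {r : ℝ}
    {s : FMTState d} {y : ℕ → Config d} {M : ℕ} (hs : s.IsValid p V r)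
    (hy : IsClearChain p V r y M) (hf : s.Follows y M) {m : ℕ} (hm : m ≤ M)
    (hun : y m ∈ s.unvisited) : ∃ j < m, y j ∈ s.active := by
  classical
  have hex : ∃ m, y m ∈ s.unvisited := ⟨m, hun⟩
  have hle : Nat.find hex ≤ m := Nat.find_min' hex hun
  have hpos : Nat.find hex ≠ 0 := fun h => hs.init_notMem (by
    have := Nat.find_spec hex
    rwa [h, hy.source] at this)
  obtain ⟨j, hj⟩ := Nat.exists_eq_succ_of_ne_zero hpos
  have hspec := Nat.find_spec hex
  have hmin := Nat.find_min hex (m := j) (by omega)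
  rw [hj] at hspec
  refine ⟨j, by omega, ?_⟩
  rcases hs.covers (y j) (hy.mem j (by omega)) with h | h | h
  · exact absurd h hmin
  · exact h
  · exact absurd hspec (hf.notMem_of_closed j (by omega) h)

theorem dist_le_sum_Ico {y : ℕ → Config d} {j m : ℕ} (h : j ≤ m) :
    (∑ i ∈ Finset.range j, dist (y i) (y (i + 1))) + dist (y j) (y m) ≤
      ∑ i ∈ Finset.range m, dist (y i) (y (i + 1)) := by
  rw [← Finset.sum_range_add_sum_Ico _ h]
  gcongr
  exact dist_le_Ico_sum_dist y h

/-- When `y m` is attached, an earlier `y j` is open with cost at most its chain length. Either `y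
j` is an admissible parent, or it is too far away and the current node, being cheapest and closer to
`y m`, does even better. In both cases the triangle inequality along the chain gives the bound. -/
theorem Follows.step {p : PlanningProblem d} {A : ArgminRule (Config d)}
    {V : Finset (Config d)} {r : ℝ} {s : FMTState d} {y : ℕ → Config d} {M : ℕ}
    (hf : s.Follows y M) (hs : s.IsValid p V r) (hy : IsClearChain p V r y M) :
    (s.step p A V r).Follows y M where
  cost_le m hm hact := by
    by_cases h : y m ∈ s.connected p A V r
    · obtain ⟨hn, hun, -⟩ := mem_connected.1 h
      rw [hs.step_cost_of_mem h]
      obtain ⟨j, hj, hja⟩ := hs.exists_active hy hf hm hun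
      have hcj := hf.cost_le j (by omega) hja
      have hsum := dist_le_sum_Ico (y := y) hj.le
      have hne : y j ≠ y m := fun h' => hs.notMem_active _ hun (h' ▸ hja)
      by_cases hd : dist (y j) (y m) < r
      · have := bestParent_le A (mem_near.2 ⟨hne, hy.mem j (by omega), hd⟩) hja
        linarith
      -- Here `dist (y j) (y m) ≥ r`, whereas the current node is within `r` of `y m` and costs no
      -- more than `y j`.
      · have h1 := bestParent_le A (hs.current_mem_near hn) hs.current_mem
        have h2 := hs.current_le _ hja
        have h3 := (mem_near.1 (hs.current_mem_near hn)).2.2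
        linarith
    · rw [step_cost_of_notMem h]
      exact hf.cost_le m hm ((mem_step_active.1 hact).2.resolve_right h)
  notMem_of_closed m hm hcl := by
    rw [mem_step_unvisited]
    rintro ⟨hun, hnc⟩
    rcases mem_step_closed.1 hcl with h | h
    · have hd := hy.dist_lt m hm
      have hn : y (m + 1) ∈ near V s.current r := by
        refine mem_near.2 ⟨?_, hy.mem _ hm, ?_⟩
        · intro h'
          exact hs.notMem_active _ hun (h' ▸ hs.current_mem)
        · rw [← h, dist_comm]
          exact hd
      -- The best parent need not lie on the chain; this is why `IsClearChain` asks for clearance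
      -- towards every point within `r`.
      refine hnc (mem_connected.2 ⟨hn, hun, hy.collisionFree _ hm _ ?_⟩)
      exact (mem_near.1 (hs.bestParent_mem A hn).1).2.2
    · exact hf.notMem_of_closed m hm h hun

theorem follows_initial {p : PlanningProblem d} {V : Finset (Config d)}
    {y : ℕ → Config d} {M : ℕ} : (initial V p.init).Follows y M where
  cost_le m _ _ := by
    rw [cost, initial, polyLength]
    · exact Finset.sum_nonneg fun _ _ => dist_nonneg
    · simp
  notMem_of_closed m _ h := by simp [initial] at h

theorem Follows.exists_active {p : PlanningProblem d} {V : Finset (Config d)} {r : ℝ}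
    {s : FMTState d} {y : ℕ → Config d} {M : ℕ} (hf : s.Follows y M) (hs : s.IsValid p V r)
    (hy : IsClearChain p V r y M) : ∃ j ≤ M, y j ∈ s.active := by
  rcases hs.covers (y M) (hy.mem M le_rfl) with h | h | h
  · obtain ⟨j, hj, hja⟩ := hs.exists_active hy hf le_rfl h
    exact ⟨j, hj.le, hja⟩
  · exact ⟨M, le_rfl, h⟩
  · exact absurd hy.target (hs.closed_notMem_goal _ h)

/-- If nothing were open, every visited vertex would be closed, so closedness would pass along the
chain from the root to `y M`. But `y M` is in the goal, and no goal vertex is ever closed. -/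
theorem step_active_nonempty {p : PlanningProblem d} {A : ArgminRule (Config d)}
    {V : Finset (Config d)} {r : ℝ} {s : FMTState d} {y : ℕ → Config d} {M : ℕ}
    (hs : s.IsValid p V r) (hgoal : s.current ∉ p.goal)
    (hy : IsClearChain p V r y M) (hf : s.Follows y M) : (s.step p A V r).active.Nonempty := by
  classical
  have hf' := hf.step (A := A) hs hy
  by_contra hempty
  rw [Finset.not_nonempty_iff_eq_empty] at hempty
  -- `IsValid.step` presupposes an open vertex, so coverage after the iteration is derived directly
  -- from the state before it.
  have hcov : ∀ v ∈ V, v ∉ (s.step p A V r).unvisited → v ∈ (s.step p A V r).closed := by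
    intro v hv hun
    by_contra hcl
    have hact : v ∉ (s.step p A V r).active := by simp [hempty]
    rw [mem_step_unvisited] at hun
    rw [mem_step_closed] at hcl
    rw [mem_step_active] at hact
    have := hs.covers v hv
    tauto
  have hall : ∀ m ≤ M, y m ∈ (s.step p A V r).closed := by
    intro m
    induction m with
    | zero =>
      intro _
      refine hcov _ (hy.mem 0 (Nat.zero_le _)) ?_
      rw [hy.source, mem_step_unvisited]
      exact fun h => hs.init_notMem h.1
    | succ m ih =>
      intro hm
      exact hcov _ (hy.mem _ hm) (hf'.notMem_of_closed m hm (ih (by omega)))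
  rcases mem_step_closed.1 (hall M le_rfl) with h | h
  · exact hgoal (h ▸ hy.target)
  · exact hs.closed_notMem_goal _ h hy.target

/-- At termination some chain vertex is still open at cost at most the chain length, and the current
node is the cheapest open one. Failure is excluded by `step_active_nonempty`, and exhaustion of the
bound by the decreasing count of unvisited and open vertices. -/
theorem run_le_of_isClearChain {p : PlanningProblem d} {A : ArgminRule (Config d)}
    {V : Finset (Config d)} {r : ℝ} {y : ℕ → Config d} {M : ℕ} (hy : IsClearChain p V r y M) :
    ∀ (k : ℕ) (s : FMTState d), s.IsValid p V r → s.Follows y M →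
    s.unvisited.card + s.active.card ≤ k →
    ∃ l, run p A V r k s = some l ∧
      polyLength l ≤ ∑ i ∈ Finset.range M, dist (y i) (y (i + 1)) := by
  have hret : ∀ s : FMTState d, s.IsValid p V r → s.Follows y M →
      polyLength (s.branch s.current) ≤ ∑ i ∈ Finset.range M, dist (y i) (y (i + 1)) := by
    intro s hs hf
    obtain ⟨j, hj, hja⟩ := hf.exists_active hs hy
    refine (hs.current_le _ hja).trans ((hf.cost_le j hj hja).trans ?_)
    exact Finset.sum_le_sum_of_subset_of_nonneg (Finset.range_mono hj)
      fun _ _ _ => dist_nonneg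
  intro k
  induction k with
  | zero =>
    intro s hs _ hk
    have := Finset.card_pos.2 ⟨_, hs.current_mem⟩
    omega
  | succ k ih =>
    intro s hs hf hk
    rw [run]
    split_ifs with h1 h2
    · exact ⟨_, rfl, hret s hs hf⟩
    · exact absurd h2 (step_active_nonempty hs h1 hy hf).ne_empty
    · refine ih _ (hs.step h1 (Finset.nonempty_iff_ne_empty.2 h2)) (hf.step hs hy) ?_
      have := step_active_card_lt p A V r s hs.current_mem
      omega

end FMTState

/-! ### Bounds for the costs of the two algorithms -/

theorem prmCost_le_fmtCost {d : ℕ} (p : PlanningProblem d) (A : ArgminRule (Config d))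
    {V : Finset (Config d)} (r : ℝ) (hV : p.init ∈ V) : prmCost p V r ≤ fmtCost p A V r := by
  unfold fmtCost
  split
  · exact le_top
  · rename_i l hl
    obtain ⟨s, hs, hgoal, rfl⟩ := FMTState.exists_isValid_of_run_eq_some _ _
      (FMTState.isValid_initial p V r hV) hl
    obtain ⟨w, hw⟩ := hs.exists_walk _ hs.current_mem
    refine (iInf₂_le_of_le s.current (hs.active_subset hs.current_mem)
      (iInf₂_le_of_le hgoal w ?_))
    rw [hw, FMTState.cost]

/-- The cost of the Fast Marching Tree solution is at most the length of any chain of vertices with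
enough clearance. -/
theorem fmtCost_le_of_isClearChain {d : ℕ} {p : PlanningProblem d} (A : ArgminRule (Config d))
    {V : Finset (Config d)} {r : ℝ} {y : ℕ → Config d} {M : ℕ}
    (hy : FMTState.IsClearChain p V r y M) :
    fmtCost p A V r ≤ ENNReal.ofReal (∑ i ∈ Finset.range M, dist (y i) (y (i + 1))) := by
  classical
  have hV : p.init ∈ V := hy.source ▸ hy.mem 0 (Nat.zero_le _)
  obtain ⟨l, hl, hle⟩ := FMTState.run_le_of_isClearChain (A := A) hy V.card _
    (FMTState.isValid_initial p V r hV) FMTState.follows_initial (by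
      simp only [FMTState.initial, Finset.card_singleton]
      convert (Finset.card_erase_add_one hV).le)
  unfold fmtCost fmtPath
  rw [hl]
  exact ENNReal.ofReal_le_ofReal hle

/-- Settles the degenerate case in which the loop stops at once; elsewhere the optimal cost is
positive, which leaves room for a relative error. -/
theorem fmtCost_eq_zero {d : ℕ} {p : PlanningProblem d} (A : ArgminRule (Config d))
    (V : Finset (Config d)) (r : ℝ) (h : p.init ∈ p.goal) : fmtCost p A V r = 0 := by
  have : fmtPath p A V r = some [p.init] := by
    unfold fmtPath
    cases V.card <;> simp [FMTState.run, FMTState.initial, h]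
  unfold fmtCost
  rw [this]
  simp [polyLength]

/-! ### Waypoints with clearance -/

/-- A path of length less than `N h` can be followed in `N` steps of size at most `h`. -/
theorem exists_waypoints {d : ℕ} {σ : ℝ → Config d} {h : ℝ} (hh : 0 < h) (N : ℕ) :
    ∀ a ≤ (1 : ℝ), ContinuousOn σ (Set.Icc a 1) →
      eVariationOn σ (Set.Icc a 1) < ENNReal.ofReal (N * h) →
      ∃ w : ℕ → Config d, w 0 = σ a ∧ w N = σ 1 ∧ (∀ i, w i ∈ σ '' Set.Icc a 1) ∧
        ∀ i, dist (w i) (w (i + 1)) ≤ h := by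
  induction N with
  | zero => intro a _ _ hlt; simp at hlt
  | succ N ih =>
    intro a ha hcont hlt
    by_cases hfar : ∃ t ∈ Set.Icc a 1, h ≤ dist (σ a) (σ t)
    · obtain ⟨t, ht, hle⟩ := hfar
      have hc : ContinuousOn (fun s => dist (σ a) (σ s)) (Set.Icc a t) :=
        (continuous_const.dist continuous_id).comp_continuousOn
          (hcont.mono (Set.Icc_subset_Icc_right ht.2))
      -- Stop at a time when the distance from `σ a` is exactly `h`: this uses up variation at least
      -- `h`, leaving less than `N h` for the remaining steps.
      obtain ⟨s, hs, hseq⟩ := intermediate_value_Icc ht.1 hc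
        (show h ∈ Set.Icc (dist (σ a) (σ a)) (dist (σ a) (σ t)) from ⟨by simp [hh.le], hle⟩)
      have hs1 : s ≤ 1 := hs.2.trans ht.2
      have hadd := eVariationOn.Icc_add_Icc σ (s := Set.univ) hs.1 hs1 (mem_univ _)
      simp only [Set.univ_inter] at hadd
      have h1 : ENNReal.ofReal h ≤ eVariationOn σ (Set.Icc a s) := by
        refine le_trans ?_ (eVariationOn.edist_le σ (left_mem_Icc.2 hs.1) (right_mem_Icc.2 hs.1))
        rw [edist_dist]
        exact ENNReal.ofReal_le_ofReal hseq.ge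
      have h2 : eVariationOn σ (Set.Icc s 1) < ENNReal.ofReal (N * h) := by
        have h3 : ENNReal.ofReal h + eVariationOn σ (Set.Icc s 1) <
            ENNReal.ofReal h + ENNReal.ofReal (N * h) := by
          rw [← ENNReal.ofReal_add hh.le (by positivity)]
          refine lt_of_le_of_lt ((add_le_add_left h1 _).trans hadd.le) (hlt.trans_le ?_)
          apply ENNReal.ofReal_le_ofReal
          push_cast
          linarith
        exact (ENNReal.add_lt_add_iff_left ENNReal.ofReal_ne_top).1 h3
      obtain ⟨w, hw0, hwN, hwm, hwd⟩ :=
        ih s hs1 (hcont.mono (Set.Icc_subset_Icc_left hs.1)) h2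
      refine ⟨fun i => Nat.casesOn i (σ a) w, rfl, hwN, ?_, ?_⟩
      · rintro (_ | i)
        · exact ⟨a, left_mem_Icc.2 ha, rfl⟩
        · exact Set.image_mono (Set.Icc_subset_Icc_left hs.1) (hwm i)
      · rintro (_ | i)
        · change dist (σ a) (w 0) ≤ h
          rw [hw0]
          exact hseq.le
        · exact hwd i
    · push Not at hfar
      -- The rest of the path stays within `h` of `σ a`, so a single step reaches the endpoint and
      -- the remaining waypoints repeat it.
      refine ⟨fun i => Nat.casesOn i (σ a) fun _ => σ 1, rfl, rfl, ?_, ?_⟩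
      · rintro (_ | i)
        · exact ⟨a, left_mem_Icc.2 ha, rfl⟩
        · exact ⟨1, right_mem_Icc.2 ha, rfl⟩
      · rintro (_ | i)
        · exact (hfar 1 (right_mem_Icc.2 ha)).le
        · simp [hh.le]

namespace PlanningProblem

variable {d : ℕ} {p : PlanningProblem d}

/-- Near every boundary point of a regular goal region there are balls inside the goal region. -/
theorem IsRegularGoal.exists_ball_subset {ξ : ℝ} (hreg : p.IsRegularGoal ξ) {x : Config d}
    (hx : x ∈ frontier p.goal) {s : ℝ} (hs : 0 ≤ s) (hsξ : s ≤ ξ) :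
    ∃ x', dist x x' ≤ s ∧ Metric.ball x' s ⊆ p.goal := by
  obtain ⟨hξ, hreg⟩ := hreg
  obtain ⟨c, hc, hxc⟩ := hreg x hx
  rw [frontier_ball c hξ.ne', Metric.mem_sphere] at hxc
  have h1 : s / ξ ≤ 1 := (div_le_one hξ).2 hsξ
  -- Move from `x` by `s` towards the centre of the regularity ball; the distance left to the centre
  -- is `ξ - s`.
  refine ⟨AffineMap.lineMap x c (s / ξ), ?_, (Metric.ball_subset_ball' ?_).trans hc⟩
  · rw [dist_left_lineMap, hxc, Real.norm_of_nonneg (by positivity), div_mul_cancel₀ _ hξ.ne']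
  · rw [dist_lineMap_right, hxc, Real.norm_of_nonneg (by linarith), sub_mul,
      div_mul_cancel₀ _ hξ.ne']
    linarith

theorem ball_subset_free {x : Config d} {ρ : ℝ} (hρ : 0 < ρ) (hx : x ∈ p.free)
    (h : ∀ o ∈ p.obs, ρ ≤ dist x o) : Metric.ball x ρ ⊆ p.free := by
  refine p.subset_free_of_isPreconnected (convex_ball x ρ).isPreconnected ?_
    (Metric.mem_ball_self hρ) hx
  refine Set.disjoint_left.2 fun o ho ho' => ?_
  rw [Metric.mem_ball, dist_comm] at ho
  linarith [h o ho']

/-- Waypoints along a feasible path with clearance, the last one slightly inside the goal. -/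
theorem exists_waypoints_to_goal {σ : ℝ → Config d} (hσ : p.IsFeasible σ) {δ ξ h s : ℝ}
    (hclear : p.HasStrongClearance σ δ) (hend : σ 1 ∈ frontier p.goal)
    (hreg : p.IsRegularGoal ξ) (hs : 0 < s) (hsh : s ≤ h) (hsξ : s ≤ ξ) {N : ℕ}
    (hlen : arcLength σ < ENNReal.ofReal (N * h)) :
    ∃ w : ℕ → Config d, w 0 = p.init ∧ Metric.ball (w (N + 1)) s ⊆ p.goal ∧
      (∀ i ≤ N, dist (w i) (w (i + 1)) ≤ h) ∧
      ∀ i, w i ∈ p.free ∧ ∀ o ∈ p.obs, δ - s ≤ dist (w i) o := by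
  obtain ⟨w, hw0, hwN, hwm, hwd⟩ :=
    exists_waypoints (hs.trans_le hsh) N 0 zero_le_one hσ.isPath.continuousOn hlen
  obtain ⟨x', hx', hball⟩ := hreg.exists_ball_subset hend hs.le hsξ
  -- The extra waypoint `N + 1` is the centre of a ball inside the goal, and moving to it costs at
  -- most `s` of the clearance.
  refine ⟨fun i => if i ≤ N then w i else x', ?_, ?_, ?_, ?_⟩
  · simp [hw0, hσ.source]
  · simpa using hball
  · intro i hi
    rcases hi.lt_or_eq with h' | rfl
    · simpa [hi, Nat.succ_le_of_lt h'] using hwd i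
    · simpa [hwN] using hx'.trans hsh
  · intro i
    dsimp only
    split_ifs with hi
    · obtain ⟨t, ht, hti⟩ := hwm i
      rw [← hti]
      exact ⟨(hclear t ht).1, fun o ho => by linarith [(hclear t ht).2 o ho]⟩
    · refine ⟨p.goal_subset (hball (Metric.mem_ball_self hs)), fun o ho => ?_⟩
      have h1 := (hclear 1 (right_mem_Icc.2 zero_le_one)).2 o ho
      have h2 := dist_triangle (σ 1) x' o
      linarith

theorem collisionFree_of_dist_lt {x u v : Config d} {r : ℝ} (h : ∀ o ∈ p.obs, r ≤ dist x o)
    (hu : dist u x < r) (hv : dist v x < r) : p.CollisionFree u v := by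
  refine Set.disjoint_left.2 fun o ho ho' => ?_
  have := (convex_ball x r).segment_subset (Metric.mem_ball.2 hu) (Metric.mem_ball.2 hv) ho
  rw [Metric.mem_ball, dist_comm] at this
  linarith [h o ho']

end PlanningProblem

open Classical in
/-- If every ball of radius `ρ` around the waypoints contains a vertex, then the cost of the Fast
Marching Tree solution is controlled by the number of balls of the smaller radius `s` without
vertices. -/
theorem fmtCost_le_of_waypoints {d : ℕ} {p : PlanningProblem d} (A : ArgminRule (Config d))
    {V : Finset (Config d)} (hV : p.init ∈ V) {w : ℕ → Config d} {M : ℕ} {r ρ s h : ℝ}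
    (hs : 0 < s) (hsρ : s ≤ ρ) (hh : 0 ≤ h) (hr : h + 2 * ρ ≤ r)
    (hw0 : w 0 = p.init) (hwM : Metric.ball (w M) s ⊆ p.goal)
    (hwd : ∀ i < M, dist (w i) (w (i + 1)) ≤ h)
    (hobs : ∀ i ≤ M, ∀ o ∈ p.obs, r + ρ ≤ dist (w i) o)
    (hbig : ∀ i ≤ M, ∃ v ∈ V, v ∈ Metric.ball (w i) ρ)
    (hlast : ∃ v ∈ V, v ∈ Metric.ball (w M) s) :
    fmtCost p A V r ≤ ENNReal.ofReal (M * (h + 2 * s) + 2 * r *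
      ((Finset.range (M + 1)).filter fun i => ∀ v ∈ V, v ∉ Metric.ball (w i) s).card) := by
  set bad := (Finset.range (M + 1)).filter fun i => ∀ v ∈ V, v ∉ Metric.ball (w i) s with hbad
  -- Choose a vertex in the small ball when there is one and otherwise in the large ball; index `0`
  -- must give the root, and indices beyond `M` play no role.
  have hex : ∀ i, ∃ v, (i ≤ M → v ∈ V ∧ dist v (w i) < ρ ∧ (i ∉ bad → dist v (w i) < s)) ∧
      (i = 0 → v = p.init) := by
    intro i
    rcases eq_or_ne i 0 with rfl | hi0
    · exact ⟨p.init, fun _ => ⟨hV, by simp [hw0]; linarith, fun _ => by simpa [hw0] using hs⟩,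
        fun _ => rfl⟩
    · by_cases hi : i ≤ M
      · by_cases hsm : ∃ v ∈ V, v ∈ Metric.ball (w i) s
        · obtain ⟨v, hvV, hv⟩ := hsm
          rw [Metric.mem_ball] at hv
          exact ⟨v, fun _ => ⟨hvV, hv.trans_le hsρ, fun _ => hv⟩, fun h => absurd h hi0⟩
        · obtain ⟨v, hvV, hv⟩ := hbig i hi
          refine ⟨v, fun _ => ⟨hvV, hv, fun h => absurd ?_ h⟩, fun h => absurd h hi0⟩
          push Not at hsm
          exact Finset.mem_filter.2 ⟨Finset.mem_range.2 (by omega), hsm⟩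
      · exact ⟨p.init, fun h => absurd h hi, fun _ => rfl⟩
  choose y hy hy0 using hex
  have hMbad : M ∉ bad := by
    obtain ⟨v, hvV, hv⟩ := hlast
    exact fun hM => (Finset.mem_filter.1 hM).2 v hvV hv
  have hstep : ∀ i < M, dist (y i) (y (i + 1)) < r := by
    intro i hi
    have h1 := (hy i hi.le).2.1
    have h2 := (hy (i + 1) hi).2.1
    have h3 := hwd i hi
    have h4 := dist_triangle4 (y i) (w i) (w (i + 1)) (y (i + 1))
    rw [dist_comm (w (i + 1))] at h4
    linarith
  have hchain : FMTState.IsClearChain p V r y M :=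
    { source := hy0 0 rfl
      target := hwM ((hy M le_rfl).2.2 hMbad)
      mem := fun m hm => (hy m hm).1
      dist_lt := hstep
      collisionFree := fun m hm u hu => by
        have h1 := (hy m hm).2.1
        -- Both endpoints lie in the ball of radius `r + ρ` about `w m`, which is convex and free of
        -- obstacles.
        refine p.collisionFree_of_dist_lt (hobs m hm) ?_ ?_
        · linarith [dist_triangle u (y m) (w m)]
        · linarith }
  refine (fmtCost_le_of_isClearChain A hchain).trans (ENNReal.ofReal_le_ofReal ?_)
  -- A step between good indices is at most `h + 2 s`; any other is shorter than `r` and is charged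
  -- to a bad endpoint. Each bad index is charged at most twice.
  set c : ℕ → ℝ := fun i => if i ∈ bad then 1 else 0 with hc
  have hc0 : ∀ i, 0 ≤ c i := fun i => by simp only [hc]; split_ifs <;> norm_num
  have hr0 : 0 ≤ r := by linarith
  have hbound : ∀ i ∈ Finset.range M,
      dist (y i) (y (i + 1)) ≤ (h + 2 * s) + r * (c i + c (i + 1)) := by
    intro i hi
    rw [Finset.mem_range] at hi
    have hle := (hstep i hi).le
    by_cases h1 : i ∈ bad
    · have : 0 ≤ r * c (i + 1) := mul_nonneg hr0 (hc0 _)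
      simp only [hc, h1, if_true] at this ⊢
      nlinarith
    by_cases h2 : i + 1 ∈ bad
    · have : 0 ≤ r * c i := mul_nonneg hr0 (hc0 _)
      simp only [hc, h2, if_true] at this ⊢
      nlinarith
    have h3 := (hy i hi.le).2.2 h1
    have h4 := (hy (i + 1) hi).2.2 h2
    have h5 := hwd i hi
    have h6 := dist_triangle4 (y i) (w i) (w (i + 1)) (y (i + 1))
    rw [dist_comm (w (i + 1))] at h6
    simp only [hc, h1, h2, if_false]
    linarith
  have hcard : ∑ i ∈ Finset.range (M + 1), c i = bad.card := by
    simp only [hc]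
    rw [Finset.sum_boole, Finset.filter_mem_eq_inter, hbad]
    congr 2
    exact Finset.inter_eq_right.2 (Finset.filter_subset _ _)
  have hsum1 : ∑ i ∈ Finset.range M, c i ≤ bad.card := by
    rw [← hcard, Finset.sum_range_succ]
    linarith [hc0 M]
  have hsum2 : ∑ i ∈ Finset.range M, c (i + 1) ≤ bad.card := by
    rw [← hcard, Finset.sum_range_succ']
    linarith [hc0 0]
  refine (Finset.sum_le_sum hbound).trans ?_
  rw [Finset.sum_add_distrib, ← Finset.mul_sum, Finset.sum_const, Finset.card_range,
    nsmul_eq_mul, Finset.sum_add_distrib]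
  linarith [mul_le_mul_of_nonneg_left (add_le_add hsum1 hsum2) hr0]

/-! ### Probability estimates -/

/-- The probability that none of `n` independent uniform samples falls into `B`. -/
theorem measure_forall_notMem_le {d n : ℕ} {Ω : Type*} [MeasurableSpace Ω] {P : Measure Ω}
    {X : Fin n → Ω → Config d} {S B : Set (Config d)}
    (hmeas : ∀ i, Measurable (X i)) (hindep : iIndepFun X P)
    (hunif : ∀ i, pdf.IsUniform (X i) S P volume)
    (hS : MeasurableSet S) (hS0 : volume S ≠ 0) (hSt : volume S ≠ ⊤)
    (hB : MeasurableSet B) (hBS : B ⊆ S) :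
    P {ω | ∀ i, X i ω ∉ B} ≤
      ENNReal.ofReal (Real.exp (-(n * ((volume B).toReal / (volume S).toReal)))) := by
  have hset : {ω | ∀ i, X i ω ∉ B} = ⋂ i, X i ⁻¹' Bᶜ := by ext ω; simp
  rw [hset, hindep.meas_iInter fun i => ⟨Bᶜ, hB.compl, rfl⟩]
  have hone : ∀ i, P (X i ⁻¹' Bᶜ) ≤
      ENNReal.ofReal (Real.exp (-((volume B).toReal / (volume S).toReal))) := by
    intro i
    have : IsProbabilityMeasure (volume[|S]) := cond_isProbabilityMeasure_of_finite hS0 hSt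
    have hu : P.map (X i) = volume[|S] := hunif i
    rw [← Measure.map_apply (hmeas i) hB.compl, hu, prob_compl_eq_one_sub hB, cond_apply hS,
      Set.inter_eq_right.2 hBS]
    have hq : (volume S)⁻¹ * volume B =
        ENNReal.ofReal ((volume B).toReal / (volume S).toReal) := by
      rw [ENNReal.ofReal_div_of_pos (ENNReal.toReal_pos hS0 hSt), ENNReal.ofReal_toReal hSt,
        ENNReal.ofReal_toReal (ne_top_of_le_ne_top hSt (measure_mono hBS)), mul_comm,
        ENNReal.div_eq_inv_mul, mul_comm]
    rw [hq, ← ENNReal.ofReal_one, ← ENNReal.ofReal_sub _ (by positivity)]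
    exact ENNReal.ofReal_le_ofReal (Real.one_sub_le_exp_neg _)
  refine (Finset.prod_le_prod' fun i _ => hone i).trans ?_
  rw [Finset.prod_const, Finset.card_univ, Fintype.card_fin,
    ← ENNReal.ofReal_pow (Real.exp_nonneg _), ← Real.exp_nat_mul, mul_neg]

open Classical in
/-- Markov's inequality for the number of events that occur. -/
theorem measure_lt_card_filter_le {Ω : Type*} [MeasurableSpace Ω] (P : Measure Ω)
    {E : ℕ → Set Ω} (hE : ∀ i, MeasurableSet (E i)) {m : ℕ} {q : ENNReal}
    (hq : ∀ i < m, P (E i) ≤ q) {c : ℝ} (hc : 0 < c) :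
    P {ω | c < ((Finset.range m).filter fun i => ω ∈ E i).card} ≤ m * q / ENNReal.ofReal c := by
  set f : Ω → ENNReal := fun ω => ∑ i ∈ Finset.range m, (E i).indicator 1 ω with hf
  have hfm : Measurable f :=
    Finset.measurable_sum _ fun i _ => measurable_one.indicator (hE i)
  have hint : ∫⁻ ω, f ω ∂P ≤ m * q := by
    rw [hf, lintegral_finsetSum _ fun i _ => measurable_one.indicator (hE i)]
    simp_rw [lintegral_indicator_one (hE _)]
    refine (Finset.sum_le_sum fun i hi => hq i (Finset.mem_range.1 hi)).trans ?_
    simp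
  have hsub : {ω | c < ((Finset.range m).filter fun i => ω ∈ E i).card} ⊆
      {ω | ENNReal.ofReal c ≤ f ω} := by
    intro ω hω
    have : f ω = (((Finset.range m).filter fun i => ω ∈ E i).card : ENNReal) := by
      simp [hf, Set.indicator_apply, Finset.sum_boole]
    rw [Set.mem_ofPred_eq, this, ← ENNReal.ofReal_natCast]
    exact ENNReal.ofReal_le_ofReal (le_of_lt hω)
  refine (measure_mono hsub).trans ?_
  rw [ENNReal.le_div_iff_mul_le (Or.inl (by simpa using hc)) (Or.inl ENNReal.ofReal_ne_top),
    mul_comm]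
  exact (mul_meas_ge_le_lintegral hfm _).trans hint

/-! ### Volumes, the connection radius, and empty balls -/

namespace PlanningProblem

variable {d : ℕ} (p : PlanningProblem d)

theorem volume_free_ne_top : volume p.free ≠ ⊤ := by
  have hb : Bornology.IsBounded (unitCube d) := by
    refine (Metric.isBounded_iff_subset_closedBall (0 : Config d)).2 ⟨Real.sqrt d, fun x hx => ?_⟩
    rw [mem_closedBall_zero_iff, EuclideanSpace.norm_eq]
    refine Real.sqrt_le_sqrt ?_
    calc ∑ i, ‖x i‖ ^ 2 ≤ ∑ _i : Fin d, (1 : ℝ) := by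
          refine Finset.sum_le_sum fun i _ => ?_
          rw [Real.norm_of_nonneg (hx i).1]
          exact pow_le_one₀ (hx i).1 (hx i).2
      _ = d := by simp
  exact ne_top_of_le_ne_top hb.measure_lt_top.ne (measure_mono p.free_subset_unitCube)

theorem volume_free_ne_zero (h : p.goal.Nonempty) : volume p.free ≠ 0 := by
  have h1 := p.isOpen_goal.measure_pos volume h
  exact (h1.trans_le (measure_mono p.goal_subset)).ne'

/-- In this form the unit-ball volume cancels in the relative volume of a ball of radius `a r_n`,
leaving `(2(1+η)a)^d / d * (log n / n)`; the exponential estimate for an empty ball becomes a pure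
power of `n`. -/
theorem radius_pow (hd : d ≠ 0) (η : ℝ) (n : ℕ) :
    p.radius η n ^ d = (2 * (1 + η)) ^ d / d *
      ((volume p.free).toReal / (volume (Metric.ball (0 : Config d) 1)).toReal) *
      (Real.log n / n) := by
  have hn := div_nonneg (Real.log_natCast_nonneg n) (Nat.cast_nonneg (α := ℝ) n)
  unfold radius
  simp only [mul_pow, one_div]
  rw [Real.rpow_inv_natCast_pow (by positivity) hd, Real.rpow_inv_natCast_pow (by positivity) hd,
    Real.rpow_inv_natCast_pow hn hd]
  ring

theorem tendsto_radius (hd : d ≠ 0) (η : ℝ) : Tendsto (p.radius η) atTop (𝓝 0) := by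
  have h1 : Tendsto (fun n : ℕ => Real.log n / n) atTop (𝓝 0) := by
    have := (Real.isLittleO_log_id_atTop.tendsto_div_nhds_zero).comp
      (tendsto_natCast_atTop_atTop (R := ℝ))
    exact this
  have h2 := (h1.rpow_const (p := 1 / (d : ℝ)) (Or.inr (by positivity))).const_mul
    ((1 + η) * 2 * (1 / (d : ℝ)) ^ (1 / (d : ℝ)) *
    ((volume p.free).toReal / (volume (Metric.ball (0 : Config d) 1)).toReal) ^ (1 / (d : ℝ)))
  rw [Real.zero_rpow (by positivity), mul_zero] at h2
  exact h2

/-- The connection radius decays at most like `n ^ (-1/d)`. -/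
theorem exists_le_radius (hd : d ≠ 0) {η : ℝ} (hη : 0 ≤ η) (hgoal : p.goal.Nonempty) :
    ∃ K : ℝ, 0 < K ∧ ∀ n : ℕ, 3 ≤ n → K * (n : ℝ) ^ (-(1 / (d : ℝ))) ≤ p.radius η n := by
  have hμ := ENNReal.toReal_pos (p.volume_free_ne_zero hgoal) p.volume_free_ne_top
  have hζ : 0 < (volume (Metric.ball (0 : Config d) 1)).toReal :=
    ENNReal.toReal_pos (Metric.measure_ball_pos volume _ one_pos).ne' measure_ball_lt_top.ne
  refine ⟨(1 + η) * 2 * (1 / (d : ℝ)) ^ (1 / (d : ℝ)) *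
    ((volume p.free).toReal / (volume (Metric.ball (0 : Config d) 1)).toReal) ^ (1 / (d : ℝ)),
    by positivity, fun n hn => ?_⟩
  have hn' : (3 : ℝ) ≤ n := by exact_mod_cast hn
  -- The threshold `3` is there because `e < 3`.
  have hlog : 1 ≤ Real.log n := by
    rw [Real.le_log_iff_exp_le (by linarith)]
    linarith [Real.exp_one_lt_d9]
  unfold radius
  refine mul_le_mul_of_nonneg_left ?_ (by positivity)
  rw [Real.rpow_neg (by positivity), ← Real.inv_rpow (by positivity)]
  refine Real.rpow_le_rpow (by positivity) ?_ (by positivity)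
  rw [← one_div]
  gcongr

/-- The probability that a ball of radius `a r_n` contains no sample. -/
theorem measure_forall_notMem_ball_le (hd : d ≠ 0) {η : ℝ} {n : ℕ} (hn : n ≠ 0)
    (hgoal : p.goal.Nonempty) {Ω : Type*} [MeasurableSpace Ω] {P : Measure Ω}
    {X : Fin n → Ω → Config d} (hmeas : ∀ i, Measurable (X i)) (hindep : iIndepFun X P)
    (hunif : ∀ i, pdf.IsUniform (X i) p.free P volume) {a : ℝ} {x : Config d}
    (ha : 0 < a * p.radius η n) (hball : Metric.ball x (a * p.radius η n) ⊆ p.free) :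
    P {ω | ∀ i, X i ω ∉ Metric.ball x (a * p.radius η n)} ≤
      ENNReal.ofReal ((n : ℝ) ^ (-((2 * (1 + η) * a) ^ d / d))) := by
  have hμ := ENNReal.toReal_pos (p.volume_free_ne_zero hgoal) p.volume_free_ne_top
  have hζ : 0 < (volume (Metric.ball (0 : Config d) 1)).toReal :=
    ENNReal.toReal_pos (Metric.measure_ball_pos volume _ one_pos).ne' measure_ball_lt_top.ne
  refine (measure_forall_notMem_le hmeas hindep hunif isClosed_closure.measurableSet
    (p.volume_free_ne_zero hgoal) p.volume_free_ne_top measurableSet_ball hball).trans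
    (ENNReal.ofReal_le_ofReal (le_of_eq ?_))
  have hn0 : (0 : ℝ) < n := by positivity
  rw [Real.rpow_def_of_pos hn0, Measure.addHaar_ball_of_pos volume _ ha, ENNReal.toReal_mul,
    ENNReal.toReal_ofReal (by positivity), finrank_euclideanSpace_fin, mul_pow, p.radius_pow hd]
  congr 1
  rw [mul_pow _ a]
  field_simp

/-- The cost of a feasible path is positive if the initial configuration is away from the goal. -/
theorem optimalCost_ne_zero (h : p.init ∉ closure p.goal) : p.optimalCost ≠ 0 := by
  have h1 : 0 < Metric.infEDist p.init (closure p.goal) := by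
    rw [Metric.infEDist_closure]
    exact Metric.infEDist_pos_iff_notMem_closure.2 h
  refine (h1.trans_le (le_iInf₂ fun σ hσ => ?_)).ne'
  refine (Metric.infEDist_le_edist_of_mem hσ.target).trans ?_
  rw [← hσ.source]
  exact eVariationOn.edist_le σ (left_mem_Icc.2 zero_le_one) (right_mem_Icc.2 zero_le_one)

end PlanningProblem

/-! ### Tail bound and passage to the limit -/

theorem mem_vertexSet {d n : ℕ} {x₀ : Config d} {x : Fin n → Config d} {v : Config d} :
    v ∈ vertexSet x₀ x ↔ v = x₀ ∨ ∃ i, x i = v := by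
  simp [vertexSet]

/-- A tail bound for the cost of the Fast Marching Tree solution in terms of a feasible path with
clearance. -/
theorem measure_lt_fmtCost_le {d n : ℕ} (hd : d ≠ 0) (hn : n ≠ 0) {p : PlanningProblem d}
    {δ ξ η : ℝ} (A : ArgminRule (Config d)) {Ω : Type*} [MeasurableSpace Ω] {P : Measure Ω}
    {X : Fin n → Ω → Config d} (hmeas : ∀ i, Measurable (X i)) (hindep : iIndepFun X P)
    (hunif : ∀ i, pdf.IsUniform (X i) p.free P volume)
    {σ : ℝ → Config d} (hσ : p.IsFeasible σ) (hclear : p.HasStrongClearance σ δ)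
    (hend : σ 1 ∈ frontier p.goal) (hreg : p.IsRegularGoal ξ) {a b θ α : ℝ} (hb : 0 < b)
    (hba : b ≤ a) (hbθ : b ≤ θ) (hθ : θ + 2 * a ≤ 1) (hα : 0 < α)
    (hr : 0 < p.radius η n) (hrδ : 3 * p.radius η n ≤ δ) (hrξ : p.radius η n ≤ ξ) {N : ℕ}
    (hlen : arcLength σ < ENNReal.ofReal (N * (θ * p.radius η n))) :
    P {ω | ENNReal.ofReal ((N + 1) * ((θ + 2 * b + 2 * α) * p.radius η n)) <
      fmtCost p A (vertexSet p.init fun i => X i ω) (p.radius η n)} ≤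
    ENNReal.ofReal ((N + 2) * (n : ℝ) ^ (-((2 * (1 + η) * a) ^ d / d)) +
      (1 + 2 / α) * (n : ℝ) ^ (-((2 * (1 + η) * b) ^ d / d))) := by
  classical
  have hgoal : p.goal.Nonempty := closure_nonempty_iff.1 ⟨_, frontier_subset_closure hend⟩
  set r := p.radius η n with hrdef
  set q₁ := (n : ℝ) ^ (-((2 * (1 + η) * a) ^ d / d)) with hq₁
  set q₂ := (n : ℝ) ^ (-((2 * (1 + η) * b) ^ d / d)) with hq₂
  have hq₁0 : 0 ≤ q₁ := by positivity
  have hq₂0 : 0 ≤ q₂ := by positivity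
  have ha : 0 < a := hb.trans_le hba
  have hbr : b * r ≤ r / 2 := by nlinarith
  have har : a * r ≤ r / 2 := by nlinarith
  have hbar : b * r ≤ a * r := by gcongr
  obtain ⟨w, hw0, hwM, hwd, hw⟩ := PlanningProblem.exists_waypoints_to_goal hσ hclear hend hreg
    (s := b * r) (h := θ * r) (by positivity) (by gcongr) (by linarith) hlen
  obtain ⟨E₁, hE₁⟩ : ∃ E : ℕ → Set Ω,
      ∀ i, E i = {ω | ∀ j, X j ω ∉ Metric.ball (w i) (a * r)} := ⟨_, fun _ => rfl⟩
  obtain ⟨E₂, hE₂⟩ : ∃ E : ℕ → Set Ω,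
      ∀ i, E i = {ω | ∀ j, X j ω ∉ Metric.ball (w i) (b * r)} := ⟨_, fun _ => rfl⟩
  have hfree : ∀ i, ∀ c ≤ 1, 0 < c * r → Metric.ball (w i) (c * r) ⊆ p.free := by
    intro i c hc hcr
    refine PlanningProblem.ball_subset_free hcr (hw i).1 fun o ho => ?_
    have := (hw i).2 o ho
    nlinarith
  have hP₁ : ∀ i, P (E₁ i) ≤ ENNReal.ofReal q₁ := fun i =>
    hE₁ i ▸ p.measure_forall_notMem_ball_le hd hn hgoal hmeas hindep hunif (by positivity)
      (hfree i a (by linarith) (by positivity))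
  have hP₂ : ∀ i, P (E₂ i) ≤ ENNReal.ofReal q₂ := fun i =>
    hE₂ i ▸ p.measure_forall_notMem_ball_le hd hn hgoal hmeas hindep hunif (by positivity)
      (hfree i b (by linarith) (by positivity))
  have hE₂m : ∀ i, MeasurableSet (E₂ i) := by
    intro i
    rw [hE₂, Set.ofPred_forall]
    exact MeasurableSet.iInter fun j => (hmeas j measurableSet_ball).compl
  -- Too many small balls are empty. The factor `2` in the bound for `P F` comes from `N + 2 ≤ 2 (N
  -- + 1)`.
  set F : Set Ω := {ω | α * (N + 1) <
    ((Finset.range (N + 2)).filter fun i => ω ∈ E₂ i).card} with hF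
  have hPF : P F ≤ ENNReal.ofReal (2 / α * q₂) := by
    have hpos : 0 < α * (N + 1) := by positivity
    refine (measure_lt_card_filter_le P hE₂m (fun i _ => hP₂ i) hpos).trans ?_
    rw [← ENNReal.ofReal_natCast, ← ENNReal.ofReal_mul (by positivity),
      ← ENNReal.ofReal_div_of_pos hpos]
    apply ENNReal.ofReal_le_ofReal
    rw [div_mul_eq_mul_div, div_le_div_iff₀ hpos hα]
    push_cast
    have : 0 ≤ q₂ * α * N := by positivity
    nlinarith
  -- A large cost requires an empty large ball, an empty small ball at the end (no vertex certified
  -- in the goal), or too many empty small balls.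
  have hsub : {ω | ENNReal.ofReal ((N + 1) * ((θ + 2 * b + 2 * α) * r)) <
      fmtCost p A (vertexSet p.init fun i => X i ω) r} ⊆
      (⋃ i ∈ Finset.range (N + 2), E₁ i) ∪ (E₂ (N + 1) ∪ F) := by
    intro ω hω
    by_contra hnot
    rw [Set.mem_ofPred_eq] at hω
    simp only [Set.mem_union, Set.mem_iUnion, not_or, not_exists, Finset.mem_range] at hnot
    obtain ⟨h1, h2, h3⟩ := hnot
    rw [hE₂] at h2
    refine not_le_of_gt hω ?_
    have hhit : ∀ i c, ω ∉ {ω | ∀ j, X j ω ∉ Metric.ball (w i) (c * r)} →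
        ∃ v ∈ vertexSet p.init fun i => X i ω, v ∈ Metric.ball (w i) (c * r) := by
      intro i c h
      simp only [Set.mem_ofPred_eq, not_forall, not_not] at h
      obtain ⟨j, hj⟩ := h
      exact ⟨_, mem_vertexSet.2 (Or.inr ⟨j, rfl⟩), hj⟩
    refine (fmtCost_le_of_waypoints A (mem_vertexSet.2 (Or.inl rfl)) (w := w) (M := N + 1)
      (ρ := a * r) (s := b * r) (h := θ * r) (by positivity) hbar (by nlinarith) (by nlinarith)
      hw0 hwM (fun i hi => hwd i (by omega)) ?_ ?_ (hhit _ _ h2)).trans ?_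
    · intro i _ o ho
      linarith [(hw i).2 o ho]
    · intro i hi
      exact hhit i a (hE₁ i ▸ h1 i (by omega))
    · apply ENNReal.ofReal_le_ofReal
      have hcard : (((Finset.range (N + 1 + 1)).filter fun i =>
          ∀ v ∈ vertexSet p.init fun i => X i ω, v ∉ Metric.ball (w i) (b * r)).card : ℝ) ≤
          α * (N + 1) := by
        refine le_trans ?_ (not_lt.1 h3)
        gcongr with i hi
        rw [hE₂]
        intro h j
        exact h _ (mem_vertexSet.2 (Or.inr ⟨j, rfl⟩))
      have := mul_le_mul_of_nonneg_left hcard (by positivity : 0 ≤ 2 * r)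
      push_cast
      refine (add_le_add_right this _).trans (le_of_eq ?_)
      ring
  refine (measure_mono hsub).trans ?_
  have hunion : P (⋃ i ∈ Finset.range (N + 2), E₁ i) ≤ ENNReal.ofReal ((N + 2) * q₁) := by
    refine (measure_biUnion_finset_le _ _).trans ((Finset.sum_le_sum fun i _ => hP₁ i).trans ?_)
    rw [Finset.sum_const, Finset.card_range, nsmul_eq_mul, ← ENNReal.ofReal_natCast,
      ← ENNReal.ofReal_mul (by positivity)]
    push_cast
    exact le_rfl
  refine (measure_union_le _ _).trans ?_
  rw [ENNReal.ofReal_add (by positivity) (by positivity), add_mul 1, one_mul,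
    ENNReal.ofReal_add hq₂0 (by positivity)]
  exact add_le_add hunion ((measure_union_le _ _).trans (add_le_add (hP₂ _) hPF))

/-- Asymptotic optimality of the Fast Marching Tree algorithm. -/
theorem tendsto_measure_lt_fmtCost {d : ℕ} (hd : 2 ≤ d) (p : PlanningProblem d) {δ ξ η : ℝ}
    (hrobust : p.IsRobustlyFeasible δ) (hregular : p.IsRegularGoal ξ)
    (hinit : p.init ∉ frontier p.goal) (hη : 0 < η) (A : ℕ → ArgminRule (Config d))
    {Ω : Type*} [MeasurableSpace Ω] (P : Measure Ω) (X : (n : ℕ) → Fin n → Ω → Config d)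
    (hmeas : ∀ n i, Measurable (X n i)) (hindep : ∀ n, iIndepFun (X n) P)
    (hunif : ∀ n i, pdf.IsUniform (X n i) p.free P volume) {ε : ℝ} (hε : 0 < ε) :
    Tendsto (fun n => P {ω | ENNReal.ofReal (1 + ε) * p.optimalCost <
      fmtCost p (A n) (vertexSet p.init fun i => X n i ω) (p.radius η n)}) atTop (𝓝 0) := by
  by_cases hmem : p.init ∈ p.goal
  · simp [fmtCost_eq_zero _ _ _ hmem]
  have hd0 : d ≠ 0 := by omega
  have hcl : p.init ∉ closure p.goal := by
    rw [closure_eq_self_union_frontier]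
    exact fun h => h.elim hmem hinit
  obtain ⟨δs, σ, hδs, -, -, hfeas, hlim, hσ⟩ := hrobust
  have hne0 := p.optimalCost_ne_zero hcl
  have hnetop : p.optimalCost ≠ ⊤ :=
    ne_top_of_le_ne_top (hfeas 0).isPath.boundedVariationOn (iInf₂_le _ (hfeas 0))
  set C := p.optimalCost.toReal with hC
  have hC0 : 0 < C := ENNReal.toReal_pos hne0 hnetop
  have hCeq : p.optimalCost = ENNReal.ofReal C := (ENNReal.ofReal_toReal hnetop).symm
  -- Chosen so that `(1 + τ)(1 + 2τ) ≤ 1 + 5τ ≤ 1 + ε`, where the first inequality uses `τ ≤ 1`.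
  set τ := min 1 (ε / 5) with hτ
  have hτ0 : 0 < τ := by positivity
  have hτ1 : τ ≤ 1 := min_le_left _ _
  have hτε : 5 * τ ≤ ε := by linarith [min_le_right 1 (ε / 5)]
  set L := (1 + τ) * C with hL
  obtain ⟨k, hk⟩ : ∃ k, arcLength (σ k) < ENNReal.ofReal L := by
    refine (hlim.eventually (gt_mem_nhds ?_)).exists
    rw [hCeq]
    exact (ENNReal.ofReal_lt_ofReal_iff (by positivity)).2 (by nlinarith)
  obtain ⟨hclear, hend, -, -⟩ := hσ k
  have hgoal : p.goal.Nonempty := closure_nonempty_iff.1 ⟨_, frontier_subset_closure hend⟩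
  -- With these values `θ + 2a = 1`, so vertices in consecutive large balls are neighbors, while
  -- `2(1+η)a = (2+2η)/(2+η) > 1` makes the exponent `e₁` exceed `1/d`.
  set a := 1 / (2 + η) with ha
  set θ := η / (2 + η) with hθ
  have hθ0 : 0 < θ := by positivity
  have hθa : θ + 2 * a ≤ 1 := by
    rw [hθ, ha]
    field_simp
    linarith
  -- Then `2b + 2α ≤ 4α = θτ`: deviations and bad steps together lengthen the chain by a factor of
  -- at most `1 + τ`.
  set α := θ * τ / 4 with hα
  have hα0 : 0 < α := by positivity
  set b := min a α with hbdef
  have hb0 : 0 < b := lt_min (by positivity) hα0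
  have hbα : b ≤ α := min_le_right _ _
  have hαθ : α ≤ θ := by nlinarith
  obtain ⟨K, hK, hKr⟩ := p.exists_le_radius hd0 hη.le hgoal
  set e₁ := (2 * (1 + η) * a) ^ d / d with he₁
  set e₂ := (2 * (1 + η) * b) ^ d / d with he₂
  have he₂0 : 0 < e₂ := by positivity
  have he₁d : 1 / (d : ℝ) < e₁ := by
    rw [he₁]
    gcongr
    refine one_lt_pow₀ ?_ hd0
    rw [ha, mul_one_div, one_lt_div (by positivity)]
    linarith
  have hrate : ∀ e : ℝ, 0 < e → Tendsto (fun n : ℕ => (n : ℝ) ^ (-e)) atTop (𝓝 0) := fun e he =>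
    (tendsto_rpow_neg_atTop he).comp (tendsto_natCast_atTop_atTop (R := ℝ))
  -- The first two terms bound `(N + 2) n^(-e₁)`, with `N + 2 ≤ L / (θ r) + 3` and `1 / r =
  -- O(n^(1/d))`. For the small balls any positive exponent `e₂` suffices, since Markov's inequality
  -- brings in no factor `N`.
  have hbound : Tendsto (fun n : ℕ => ENNReal.ofReal
      (L / (θ * K) * (n : ℝ) ^ (-(e₁ - 1 / d)) + 3 * (n : ℝ) ^ (-e₁) +
        (1 + 2 / α) * (n : ℝ) ^ (-e₂))) atTop (𝓝 0) := by
    have h := (((hrate _ (sub_pos.2 he₁d)).const_mul (L / (θ * K))).add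
      ((hrate e₁ (lt_trans (by positivity) he₁d)).const_mul 3)).add
      ((hrate e₂ he₂0).const_mul (1 + 2 / α))
    simp only [mul_zero, add_zero] at h
    simpa using ENNReal.tendsto_ofReal h
  refine tendsto_of_tendsto_of_tendsto_of_le_of_le' tendsto_const_nhds hbound
    (Eventually.of_forall fun _ => zero_le) ?_
  have hrad := p.tendsto_radius hd0 η
  -- The last condition, `θ r < τ C / 2`, pays for the two additional steps in `N + 1 ≤ L / (θ r) +
  -- 2`.
  filter_upwards [eventually_ge_atTop 3,
    hrad.eventually (gt_mem_nhds (show (0 : ℝ) < δs k / 3 from div_pos (hδs k) three_pos)),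
    hrad.eventually (gt_mem_nhds hregular.1),
    hrad.eventually (gt_mem_nhds (show 0 < τ * C / (2 * θ) by positivity))] with n hn h1 h2 h3
  have hn0 : n ≠ 0 := by omega
  have hnpos : (0 : ℝ) < n := by positivity
  have hKn := hKr n hn
  set r := p.radius η n with hr
  have hr0 : 0 < r := lt_of_lt_of_le (by positivity) hKn
  set N := ⌊L / (θ * r)⌋₊ + 1 with hN
  have hNlt : L < N * (θ * r) := by
    rw [← div_lt_iff₀ (by positivity), hN]
    push_cast
    exact Nat.lt_floor_add_one _
  have hNle : (N : ℝ) ≤ L / (θ * r) + 1 := by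
    rw [hN]
    push_cast
    gcongr
    exact Nat.floor_le (by positivity)
  have htail := measure_lt_fmtCost_le hd0 hn0 (A n) (hmeas n) (hindep n) (hunif n) (hfeas k)
    hclear hend hregular hb0 (min_le_left a α) (hbα.trans hαθ) hθa hα0 hr0 (by linarith) h2.le
    (N := N) (hk.trans_le (ENNReal.ofReal_le_ofReal hNlt.le))
  refine (measure_mono ?_).trans (htail.trans (ENNReal.ofReal_le_ofReal ?_))
  · intro ω hω
    rw [Set.mem_ofPred_eq] at hω ⊢
    refine lt_of_le_of_lt ?_ hω
    rw [hCeq, ← ENNReal.ofReal_mul (by positivity)]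
    apply ENNReal.ofReal_le_ofReal
    have h4 : θ * r < τ * C / 2 := by
      rw [lt_div_iff₀ (by positivity)] at h3
      linarith
    have h5 : (N + 1) * (θ * r) ≤ (1 + 2 * τ) * C := by
      have h6 : (N : ℝ) * (θ * r) ≤ (L / (θ * r) + 1) * (θ * r) := by gcongr
      rw [add_mul, div_mul_cancel₀ _ (by positivity)] at h6
      linarith
    have h6 : (θ + 2 * b + 2 * α) * r ≤ (1 + τ) * (θ * r) := by
      have : θ + 2 * b + 2 * α ≤ (1 + τ) * θ := by linarith
      nlinarith
    calc ((N : ℝ) + 1) * ((θ + 2 * b + 2 * α) * r)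
        ≤ (N + 1) * ((1 + τ) * (θ * r)) := by gcongr
      _ = (1 + τ) * ((N + 1) * (θ * r)) := by ring
      _ ≤ (1 + τ) * ((1 + 2 * τ) * C) := by gcongr
      _ = ((1 + τ) * (1 + 2 * τ)) * C := by ring
      _ ≤ (1 + ε) * C := by gcongr; nlinarith
  · gcongr
    have h4 : L / (θ * r) ≤ L / (θ * K) * (n : ℝ) ^ (1 / (d : ℝ)) := by
      calc L / (θ * r) ≤ L / (θ * (K * (n : ℝ) ^ (-(1 / (d : ℝ))))) := by gcongr
        _ = L / (θ * K) * (n : ℝ) ^ (1 / (d : ℝ)) := by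
          rw [Real.rpow_neg hnpos.le]
          field_simp
    have h5 : (n : ℝ) ^ (-(e₁ - 1 / d)) = (n : ℝ) ^ (1 / (d : ℝ)) * (n : ℝ) ^ (-e₁) := by
      rw [← Real.rpow_add hnpos]
      ring_nf
    rw [h5, ← mul_assoc, ← add_mul]
    exact mul_le_mul_of_nonneg_right (by linarith) (by positivity)

theorem theorem3 {d : ℕ} (hd : 2 ≤ d) (p : PlanningProblem d) (δ ξ η : ℝ)
    (hδ : 0 < δ) (hrobust : p.IsRobustlyFeasible δ)
    (hregular : p.IsRegularGoal ξ)
    (hinit : p.init ∉ frontier p.goal)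
    (hη : 0 < η)
    (A : ℕ → ArgminRule (Config d))
    {Ω : Type*} [MeasurableSpace Ω] (P : Measure Ω) [IsProbabilityMeasure P]
    (X : (n : ℕ) → Fin n → Ω → Config d)
    (hmeas : ∀ n i, Measurable (X n i))
    (hindep : ∀ n, iIndepFun (X n) P)
    (hunif : ∀ n i, pdf.IsUniform (X n i) p.free P volume) :
    (∀ n ω, p.optimalCost ≤
        fmtCost p (A n) (vertexSet p.init fun i => X n i ω) (p.radius η n)) ∧
    (∀ n ω, p.optimalCost ≤
        prmCost p (vertexSet p.init fun i => X n i ω) (p.radius η n)) ∧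
    ∀ ε : ℝ, 0 < ε →
      Tendsto (fun n => P {ω | ENNReal.ofReal (1 + ε) * p.optimalCost <
        fmtCost p (A n) (vertexSet p.init fun i => X n i ω) (p.radius η n)}) atTop (𝓝 0) ∧
      Tendsto (fun n => P {ω | ENNReal.ofReal (1 + ε) * p.optimalCost <
        prmCost p (vertexSet p.init fun i => X n i ω) (p.radius η n)}) atTop (𝓝 0) := by
  have hV : ∀ n ω, p.init ∈ vertexSet p.init fun i => X n i ω := fun n ω =>
    mem_vertexSet.2 (Or.inl rfl)
  have hle : ∀ n ω, prmCost p (vertexSet p.init fun i => X n i ω) (p.radius η n) ≤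
      fmtCost p (A n) (vertexSet p.init fun i => X n i ω) (p.radius η n) := fun n ω =>
    prmCost_le_fmtCost p (A n) _ (hV n ω)
  refine ⟨fun n ω => (optimalCost_le_prmCost _ _ _).trans (hle n ω),
    fun n ω => optimalCost_le_prmCost _ _ _, fun ε hε => ?_⟩
  have hfmt := tendsto_measure_lt_fmtCost hd p hrobust hregular hinit hη A P X hmeas hindep hunif hε
  exact ⟨hfmt, tendsto_of_tendsto_of_tendsto_of_le_of_le tendsto_const_nhds hfmt
    (fun _ => zero_le) fun n => measure_mono fun ω hω => lt_of_lt_of_le hω (hle n ω)⟩
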